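/- Let $n\ge 0$ and let $\Omega\subset\mathbb R^n$ be an open set. For an open set $U\subset\mathbb R^n$ let $C_0^\infty(U)$ be the set of smooth functions $u:\mathbb R^n\to\mathbb R$ with compact support contained in $U$. For $q>1$ and a compact set $K\subset U$, the variational $q$-capacity is $$\operatorname{cap}_q(K,U)=\inf\Big\{\int_U|\nabla u|^q\,dx:\ u\in C_0^\infty(U),\ u\ge 1\text{ on }K\Big\}.$$ A closed set $E\subset\mathbb R^n$ is called uniformly $q$-fat if there is a constant $c>0$ such that $$\operatorname{cap}_q\big(E\cap\overline B(x,r),B(x,2r)\big)\ \ge\ c\,r^{n-q}\qquad\text{for all }x\in E\text{ and all }r>0.$$ Let $s\ge 1$, and assume that $\mathbb R^n\setminus\Omega$ is uniformly $q$-fat for every real $q>s$ (with a constant that may depend on $q$). Let $1<p<\infty$ and let $\beta\in\mathbb R$ with $\beta<p-s$. Then $\Omega$ admits the $(p,\beta)$-Hardy inequality: there is a constant $C>0$ such that $$\int_\Omega|u(x)|^p\,d_\Omega(x)^{\beta-p}\,dx\ \le\ C\int_\Omega|\nabla u(x)|^p\,d_\Omega(x)^{\beta}\,dx\qquad\text{for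 every }u\in C_0^\infty(\Omega),$$ where $d_\Omega(x)=\operatorname{dist}(x,\partial\Omega)$. (If $\partial\Omega=\emptyset$, then $d_\Omega=\infty$ on $\Omega$ and $\infty^{\beta-p}=0$, so the inequality holds trivially.) -/

import Mathlib

open MeasureTheory
open scoped ENNReal NNReal ContDiff

/-- The class `C₀^∞(U)`: smooth real functions on `ℝⁿ` with compact support contained in `U`. -/
def IsTestFunction {n : ℕ} (U : Set (EuclideanSpace ℝ (Fin n)))
    (u : EuclideanSpace ℝ (Fin n) → ℝ) : Prop :=
  ContDiff ℝ ∞ u ∧ HasCompactSupport u ∧ tsupport u ⊆ U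

/-- The variational `q`-capacity of the condenser `(K, U)`: the infimum of `∫_U |∇u|^q dx` over all
`u ∈ C₀^∞(U)` with `u ≥ 1` on `K`. The operator norm of `fderiv ℝ u x` is the Euclidean norm of the
gradient of `u` at `x`. -/
noncomputable def variationalCapacity {n : ℕ} (q : ℝ)
    (K U : Set (EuclideanSpace ℝ (Fin n))) : ℝ≥0∞ :=
  ⨅ (u : EuclideanSpace ℝ (Fin n) → ℝ) (_ : IsTestFunction U u) (_ : ∀ x ∈ K, 1 ≤ u x),
    ∫⁻ x in U, ‖fderiv ℝ u x‖ₑ ^ q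

/-- Uniform `q`-fatness of a closed set `E ⊆ ℝⁿ`: at every point of `E` and at every scale `r`, the
`q`-capacity of `E` is bounded below by a fixed multiple of `r ^ (n - q)`, the order of the
`q`-capacity of a full ball of radius `r`. -/
def UniformlyFat {n : ℕ} (q : ℝ) (E : Set (EuclideanSpace ℝ (Fin n))) : Prop :=
  ∃ c : ℝ, 0 < c ∧ ∀ x ∈ E, ∀ r : ℝ, 0 < r →
    ENNReal.ofReal (c * r ^ ((n : ℝ) - q)) ≤
      variationalCapacity q (E ∩ Metric.closedBall x r) (Metric.ball x (2 * r))

/-- `Ω` admits the `(p, β)`-Hardy inequality: for some finite `C > 0` and all `u ∈ C₀^∞(Ω)`,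
`∫_Ω |u|^p d^(β - p) dx ≤ C ∫_Ω |∇u|^p d^β dx`, with `d x = dist(x, ∂Ω)`. The distance takes values
in `[0, ∞]`; for `x ∈ Ω` it is positive, and it is infinite exactly when `∂Ω` is empty. -/
def AdmitsHardyInequality {n : ℕ} (p β : ℝ) (Ω : Set (EuclideanSpace ℝ (Fin n))) : Prop :=
  ∃ C : ℝ≥0, 0 < C ∧ ∀ u : EuclideanSpace ℝ (Fin n) → ℝ, IsTestFunction Ω u →
    ∫⁻ x in Ω, ‖u x‖ₑ ^ p * Metric.infEDist x (frontier Ω) ^ (β - p) ≤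
      (C : ℝ≥0∞) * ∫⁻ x in Ω, ‖fderiv ℝ u x‖ₑ ^ p * Metric.infEDist x (frontier Ω) ^ β

/-! The exponent `p` enters only at the end: applying a `(1, 1 - q)`-Hardy inequality with `q = p -
β` to `|u| ^ p`, then Hölder, bounds the left side `I` by a constant times `I ^ ((p-1)/p) * J ^
(1/p)`, where `J` is the weighted gradient integral. Since `I` is finite, its power can be absorbed.
Because `q > s`, fatness is available at some `q₀` strictly between, and the gap `q - q₀` pays for
every loss.

The core is a local estimate (`lintegral_ball_le_of_uniformlyFat`). Let `D` be the distance from `x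
∈ Ω` to the complement. If `∫ |u|` over `B(x, D)` is large, then at no complement point `w` near
`x`, where `u w = 0`, can `∫ |∇u|` over `B(w, tR)` decay like `t ^ (n-1+δ)`. So each `w` has a
radius `r` at which the gradient integral is large. On `B(w, r)` the distance to the complement is
at most `r`, so inserting the weight `d ^ (1-q₀-δ)` turns this into a lower bound proportional to `r
^ (n-q₀)`. A disjoint Vitali family of these balls, once enlarged, covers the nearby complement, and
fatness bounds `∑ r ^ (n-q₀)` below by a multiple of `D ^ (n-q₀)` through
`variationalCapacity_le_sum`. Only the content of the complement is used, so no capacitary Poincaré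
inequality or self-improvement of fatness is needed.

Integrating the local estimates over `x` against a power of the distance and exchanging integrals
gives the global inequality for exponent one. -/

/-! ### Mean size of a function near one of its zeros. -/

section StarShaped

variable {E : Type*} [NormedAddCommGroup E] [NormedSpace ℝ E]

theorem enorm_sub_le_lintegral_fderiv {u : E → ℝ} (hu : ContDiff ℝ 1 u) (w z : E) :
    ‖u (w + z) - u w‖ₑ ≤ ∫⁻ t in Set.Ioc (0 : ℝ) 1, ‖fderiv ℝ u (w + t • z)‖ₑ * ‖z‖ₑ := by
  have hcont : Continuous fun t : ℝ => fderiv ℝ u (w + t • z) z :=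
    ((hu.continuous_fderiv one_ne_zero).comp (by fun_prop)).clm_apply continuous_const
  have hderiv : ∀ t : ℝ, HasDerivAt (fun t : ℝ => u (w + t • z)) (fderiv ℝ u (w + t • z) z) t := by
    intro t
    have h1 : HasDerivAt (fun t : ℝ => w + t • z) z t := by
      simpa using ((hasDerivAt_id t).smul_const z).const_add w
    exact (hu.differentiable one_ne_zero _).hasFDerivAt.comp_hasDerivAt t h1
  have hftc := intervalIntegral.integral_eq_sub_of_hasDerivAt (a := 0) (b := 1)
    (fun t _ => hderiv t) (hcont.intervalIntegrable _ _)
  simp only [one_smul, zero_smul, add_zero] at hftc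
  rw [← hftc, intervalIntegral.integral_of_le zero_le_one]
  refine (enorm_integral_le_lintegral_enorm _).trans (lintegral_mono fun t => ?_)
  exact ContinuousLinearMap.le_opENorm _ _

theorem lintegral_rpow_sub_one_Ioc {δ : ℝ} (hδ : 0 < δ) :
    ∫⁻ t in Set.Ioc (0 : ℝ) 1, ENNReal.ofReal (t ^ (δ - 1)) = ENNReal.ofReal δ⁻¹ := by
  have hint : IntervalIntegrable (fun t : ℝ => t ^ (δ - 1)) volume 0 1 :=
    intervalIntegral.intervalIntegrable_rpow' (by linarith)
  rw [← ofReal_integral_eq_lintegral_ofReal]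
  · rw [← intervalIntegral.integral_of_le zero_le_one, integral_rpow (Or.inl (by linarith))]
    simp [hδ.ne', Real.zero_rpow]
  · exact (intervalIntegrable_iff_integrableOn_Ioc_of_le zero_le_one).1 hint
  · filter_upwards [ae_restrict_mem measurableSet_Ioc] with t ht
    exact Real.rpow_nonneg ht.1.le _

variable [FiniteDimensional ℝ E] [MeasurableSpace E] [BorelSpace E]

theorem lintegral_comp_add_smul (μ : Measure E) [μ.IsAddHaarMeasure] {f : E → ℝ≥0∞}
    (hf : Measurable f) (w : E) {t : ℝ} (ht : 0 < t) :
    ∫⁻ z, f (w + t • z) ∂μ = ENNReal.ofReal (t ^ (-(Module.finrank ℝ E : ℝ))) * ∫⁻ y, f y ∂μ := by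
  have h1 : ∫⁻ z, f (w + t • z) ∂μ = ∫⁻ y, f (w + y) ∂(Measure.map (t • ·) μ) :=
    (lintegral_map (hf.comp (measurable_const_add w)) (measurable_const_smul t)).symm
  rw [h1, Measure.map_addHaar_smul μ ht.ne', lintegral_smul_measure, lintegral_add_left_eq_self,
    smul_eq_mul, abs_of_pos (by positivity), Real.rpow_neg ht.le, Real.rpow_natCast]

/-- If `u` vanishes at `w` and the mean oscillation of `u` around `w` decays at a power rate, then
`u` is small in mean near `w`. -/
theorem lintegral_ball_enorm_le_of_decay (μ : Measure E) [μ.IsAddHaarMeasure]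
    {u : E → ℝ} (hu : ContDiff ℝ 1 u) {w : E} (hw : u w = 0) {a R δ : ℝ} (ha : 0 ≤ a) (hR : 0 < R)
    (hδ : 0 < δ)
    (h : ∀ t ∈ Set.Ioc (0 : ℝ) 1, ∫⁻ y in Metric.ball w (t * R), ‖fderiv ℝ u y‖ₑ ∂μ ≤
      ENNReal.ofReal (a * t ^ (Module.finrank ℝ E - 1 + δ))) :
    ∫⁻ y in Metric.ball w R, ‖u y‖ₑ ∂μ ≤ ENNReal.ofReal (a * R / δ) := by
  have hg : Continuous fun y => ‖fderiv ℝ u y‖ₑ := (hu.continuous_fderiv one_ne_zero).enorm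
  set F : ℝ → E → ℝ≥0∞ := fun t => (Metric.ball w (t * R)).indicator fun y => ‖fderiv ℝ u y‖ₑ
    with hF
  have hFm : ∀ t, Measurable (F t) := fun t => hg.measurable.indicator measurableSet_ball
  have hjoint : Measurable fun p : E × ℝ => F p.2 (w + p.2 • p.1) := by
    have hopen : IsOpen {p : E × ℝ | dist (w + p.2 • p.1) w < p.2 * R} :=
      isOpen_lt (by fun_prop) (by fun_prop)
    have h1 : Measurable fun p : E × ℝ => ‖fderiv ℝ u (w + p.2 • p.1)‖ₑ :=
      (hg.comp (by fun_prop : Continuous fun p : E × ℝ => w + p.2 • p.1)).measurable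
    exact h1.indicator hopen.measurableSet
  calc ∫⁻ y in Metric.ball w R, ‖u y‖ₑ ∂μ
      = ∫⁻ z, (Metric.ball w R).indicator (fun y => ‖u y‖ₑ) (w + z) ∂μ := by
        rw [lintegral_add_left_eq_self (fun y => (Metric.ball w R).indicator (fun y => ‖u y‖ₑ) y) w,
          lintegral_indicator measurableSet_ball]
    -- The segment from `w` to `w + z` is at time `t` inside the shrunken ball `B(w, tR)`, so the
    -- indicator in `F t` loses nothing.
    _ ≤ ∫⁻ z, (∫⁻ t in Set.Ioc (0 : ℝ) 1, F t (w + t • z) * ENNReal.ofReal R) ∂μ := by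
        refine lintegral_mono fun z => ?_
        by_cases hz : w + z ∈ Metric.ball w R
        · rw [Set.indicator_of_mem hz]
          have hzR : ‖z‖ < R := by simpa [dist_eq_norm] using hz
          have h1 := enorm_sub_le_lintegral_fderiv hu w z
          rw [hw, sub_zero] at h1
          refine h1.trans (setLIntegral_mono' measurableSet_Ioc fun t ht => ?_)
          have hmem : w + t • z ∈ Metric.ball w (t * R) := by
            simpa [dist_eq_norm, norm_smul, abs_of_pos ht.1, ht.1] using hzR
          rw [hF]
          simp only [Set.indicator_of_mem hmem]
          gcongr
          rw [← ofReal_norm]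
          exact ENNReal.ofReal_le_ofReal hzR.le
        · rw [Set.indicator_of_notMem hz]
          exact zero_le
    _ = ∫⁻ t in Set.Ioc (0 : ℝ) 1, (∫⁻ z, F t (w + t • z) * ENNReal.ofReal R ∂μ) :=
        lintegral_lintegral_swap (hjoint.mul_const _).aemeasurable
    -- Undoing the dilation by `t` costs `t ^ (-n)`; the assumed decay leaves `t ^ (δ - 1)`, which
    -- is integrable at `0` exactly because `δ > 0`.
    _ ≤ ∫⁻ t in Set.Ioc (0 : ℝ) 1, ENNReal.ofReal (a * R) * ENNReal.ofReal (t ^ (δ - 1)) := by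
        refine setLIntegral_mono' measurableSet_Ioc fun t ht => ?_
        rw [lintegral_mul_const _ (show Measurable fun z => F t (w + t • z) from
          (hFm t).comp (by fun_prop)),
          lintegral_comp_add_smul μ (hFm t) w ht.1, hF, lintegral_indicator measurableSet_ball]
        calc _ ≤ ENNReal.ofReal (t ^ (-(Module.finrank ℝ E : ℝ))) *
              ENNReal.ofReal (a * t ^ (Module.finrank ℝ E - 1 + δ)) * ENNReal.ofReal R := by
              gcongr
              exact h t ht
          _ = _ := by
              have ht0 := ht.1
              rw [← ENNReal.ofReal_mul (by positivity), ← ENNReal.ofReal_mul (by positivity),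
                ← ENNReal.ofReal_mul (by positivity)]
              congr 1
              have : t ^ (δ - 1) = t ^ (-(Module.finrank ℝ E : ℝ)) *
                  t ^ (Module.finrank ℝ E - 1 + δ) := by
                rw [← Real.rpow_add ht0]; congr 1; ring
              rw [this]; ring
    _ = ENNReal.ofReal (a * R / δ) := by
        rw [lintegral_const_mul _ (by fun_prop), lintegral_rpow_sub_one_Ioc hδ,
          ← ENNReal.ofReal_mul (by positivity), div_eq_mul_inv]

end StarShaped

/-! ### Capacity bounded by sums of powers of radii of covering balls. -/

section Capacity

/-- The `ℓ^q` norm of a finite family of positive differentiable functions has derivative bounded by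
the `ℓ^q` norm of the derivatives. -/
theorem exists_hasFDerivAt_rpow_sum {E ι : Type*} [NormedAddCommGroup E] [NormedSpace ℝ E]
    {s : Finset ι} (hs : s.Nonempty) {q : ℝ} (hq : 1 < q) {f : ι → E → ℝ} {f' : ι → E →L[ℝ] ℝ}
    {x : E} (hpos : ∀ i ∈ s, 0 < f i x) (hf : ∀ i ∈ s, HasFDerivAt (f i) (f' i) x) :
    ∃ L : E →L[ℝ] ℝ, HasFDerivAt (fun y => (∑ i ∈ s, f i y ^ q) ^ (1 / q)) L x ∧
      ‖L‖ ^ q ≤ ∑ i ∈ s, ‖f' i‖ ^ q := by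
  have hq0 : 0 < q := by linarith
  set S := ∑ i ∈ s, f i x ^ q with hS
  have hSpos : 0 < S := Finset.sum_pos (fun i hi => Real.rpow_pos_of_pos (hpos i hi) _) hs
  have hsum : HasFDerivAt (fun y => ∑ i ∈ s, f i y ^ q)
      (∑ i ∈ s, (q * f i x ^ (q - 1)) • f' i) x :=
    HasFDerivAt.fun_sum fun i hi => (hf i hi).rpow_const (Or.inl (hpos i hi).ne')
  refine ⟨_, hsum.rpow_const (Or.inl hSpos.ne'), ?_⟩
  rw [← hS]
  set T := ∑ i ∈ s, ‖f' i‖ ^ q with hT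
  have hT0 : 0 ≤ T := Finset.sum_nonneg fun i _ => by positivity
  have hhol : ∑ i ∈ s, f i x ^ (q - 1) * ‖f' i‖ ≤ S ^ ((q - 1) / q) * T ^ (1 / q) := by
    have hconj : (q / (q - 1)).HolderConjugate q :=
      (Real.HolderConjugate.conjExponent hq).symm
    have h1 := Real.inner_le_Lp_mul_Lq_of_nonneg s hconj (f := fun i => f i x ^ (q - 1))
      (g := fun i => ‖f' i‖) (fun i hi => Real.rpow_nonneg (hpos i hi).le _)
      (fun i _ => norm_nonneg _)
    have h2 : ∑ i ∈ s, (f i x ^ (q - 1)) ^ (q / (q - 1)) = S := by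
      refine Finset.sum_congr rfl fun i hi => ?_
      rw [← Real.rpow_mul (hpos i hi).le]
      congr 1
      field_simp [(sub_pos.2 hq).ne']
    rwa [h2, one_div_div] at h1
  have hnorm : ‖(1 / q * S ^ (1 / q - 1)) • ∑ i ∈ s, (q * f i x ^ (q - 1)) • f' i‖ ≤
      T ^ (1 / q) := by
    calc _ = 1 / q * S ^ (1 / q - 1) * ‖∑ i ∈ s, (q * f i x ^ (q - 1)) • f' i‖ := by
          rw [norm_smul, Real.norm_of_nonneg (by positivity)]
      _ ≤ 1 / q * S ^ (1 / q - 1) * ∑ i ∈ s, q * (f i x ^ (q - 1) * ‖f' i‖) := by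
          gcongr
          refine norm_sum_le_of_le _ fun i hi => ?_
          have := hpos i hi
          rw [norm_smul, Real.norm_of_nonneg (by positivity), mul_assoc]
      _ ≤ 1 / q * S ^ (1 / q - 1) * (q * (S ^ ((q - 1) / q) * T ^ (1 / q))) := by
          rw [← Finset.mul_sum]
          gcongr
      _ = S ^ (1 / q - 1) * S ^ ((q - 1) / q) * T ^ (1 / q) := by
          field_simp
      _ = T ^ (1 / q) := by
          rw [← Real.rpow_add hSpos, show 1 / q - 1 + (q - 1) / q = 0 by field_simp; ring,
            Real.rpow_zero, one_mul]
  calc _ ≤ (T ^ (1 / q)) ^ q := Real.rpow_le_rpow (norm_nonneg _) hnorm hq0.le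
    _ = T := by rw [← Real.rpow_mul hT0, one_div_mul_cancel hq0.ne', Real.rpow_one]

/-- Smooth cutoffs of balls, with the scale-invariant bound on their Dirichlet energy. -/
theorem exists_cutoff_energy_le (n : ℕ) {q : ℝ} (hq : 0 < q) :
    ∃ C : ℝ, 0 < C ∧ ∀ (w : EuclideanSpace ℝ (Fin n)) (ρ : ℝ), 0 < ρ →
      ∃ φ : EuclideanSpace ℝ (Fin n) → ℝ, ContDiff ℝ ∞ φ ∧ (∀ x, 0 ≤ φ x) ∧
        (∀ x ∈ Metric.ball w ρ, φ x = 1) ∧ (∀ x ∉ Metric.closedBall w (2 * ρ), φ x = 0) ∧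
        ∫⁻ x, ‖fderiv ℝ φ x‖ₑ ^ q ≤ ENNReal.ofReal (C * ρ ^ ((n : ℝ) - q)) := by
  let b : ContDiffBump (0 : EuclideanSpace ℝ (Fin n)) := ⟨1, 2, one_pos, one_lt_two⟩
  have hbs : ContDiff ℝ ∞ b := b.contDiff
  have hbc : Continuous (fderiv ℝ b) := hbs.continuous_fderiv (by simp)
  set I := ∫⁻ x, ‖fderiv ℝ b x‖ₑ ^ q with hI
  have hItop : I ≠ ⊤ := by
    have hcs : HasCompactSupport (fun x => ‖fderiv ℝ b x‖ ^ q) :=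
      (b.hasCompactSupport.fderiv ℝ).comp_left (g := fun L => ‖L‖ ^ q) (by simp [hq.ne'])
    have hint : Integrable (fun x => ‖fderiv ℝ b x‖ ^ q) :=
      (hbc.norm.rpow_const fun _ => Or.inr hq.le).integrable_of_hasCompactSupport hcs
    have := hint.lintegral_lt_top
    refine (lt_of_le_of_lt (le_of_eq ?_) this).ne
    refine lintegral_congr fun x => ?_
    rw [← ENNReal.ofReal_rpow_of_nonneg (norm_nonneg _) hq.le, ofReal_norm]
  refine ⟨I.toReal + 1, by positivity, fun w ρ hρ => ⟨fun x => b (ρ⁻¹ • (x - w)), ?_, ?_, ?_, ?_, ?_⟩⟩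
  · exact hbs.comp (by fun_prop)
  · exact fun x => b.nonneg
  · intro x hx
    refine b.one_of_mem_closedBall ?_
    rw [mem_closedBall_zero_iff, norm_smul, norm_inv, Real.norm_of_nonneg hρ.le,
      inv_mul_le_iff₀ hρ]
    simpa [dist_eq_norm, b] using (Metric.mem_ball.1 hx).le
  · intro x hx
    refine b.zero_of_le_dist ?_
    rw [dist_zero_right, norm_smul, norm_inv, Real.norm_of_nonneg hρ.le, le_inv_mul_iff₀ hρ]
    rw [Metric.mem_closedBall, not_le, dist_eq_norm] at hx
    simp only [b]
    linarith
  · have hder : ∀ x, fderiv ℝ (fun x => b (ρ⁻¹ • (x - w))) x =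
        ρ⁻¹ • fderiv ℝ b (ρ⁻¹ • (x - w)) := by
      intro x
      have h1 : HasFDerivAt (fun x : EuclideanSpace ℝ (Fin n) => ρ⁻¹ • (x - w))
          (ρ⁻¹ • ContinuousLinearMap.id ℝ _) x :=
        ((hasFDerivAt_id x).sub_const w).const_smul ρ⁻¹
      have h2 := ((hbs.differentiable (by simp)) (ρ⁻¹ • (x - w))).hasFDerivAt.comp x h1
      rw [ContinuousLinearMap.comp_smul, ContinuousLinearMap.comp_id] at h2
      exact h2.fderiv
    set G : EuclideanSpace ℝ (Fin n) → ℝ≥0∞ := fun x => ‖fderiv ℝ b x‖ₑ ^ q with hG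
    have hGm : Measurable G := (hbc.enorm.measurable).pow_const q
    have hρi : 0 < ρ⁻¹ := inv_pos.2 hρ
    have hscale : ∫⁻ x, G (ρ⁻¹ • (x - w)) = ENNReal.ofReal (ρ ^ (n : ℝ)) * I := by
      have := lintegral_comp_add_smul volume hGm (-(ρ⁻¹ • w)) hρi
      rw [finrank_euclideanSpace_fin, Real.inv_rpow hρ.le, Real.rpow_neg hρ.le, inv_inv] at this
      rw [← this]
      refine lintegral_congr fun x => ?_
      rw [smul_sub, neg_add_eq_sub]
    calc ∫⁻ x, ‖fderiv ℝ (fun x => b (ρ⁻¹ • (x - w))) x‖ₑ ^ q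
        = ∫⁻ x, ENNReal.ofReal (ρ ^ (-q)) * G (ρ⁻¹ • (x - w)) := by
          refine lintegral_congr fun x => ?_
          rw [hder, enorm_smul, ENNReal.mul_rpow_of_nonneg _ _ hq.le, Real.enorm_of_nonneg hρi.le,
            ENNReal.ofReal_rpow_of_pos hρi, Real.inv_rpow hρ.le, Real.rpow_neg hρ.le]
      _ = ENNReal.ofReal (ρ ^ (-q)) * (ENNReal.ofReal (ρ ^ (n : ℝ)) * I) := by
          rw [lintegral_const_mul' _ _ ENNReal.ofReal_ne_top, hscale]
      _ = ENNReal.ofReal (I.toReal * ρ ^ ((n : ℝ) - q)) := by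
          conv_lhs => rw [← ENNReal.ofReal_toReal hItop]
          rw [← ENNReal.ofReal_mul (by positivity), ← ENNReal.ofReal_mul (by positivity)]
          congr 1
          rw [sub_eq_add_neg, Real.rpow_add hρ]
          ring
      _ ≤ _ := by
          gcongr
          linarith

/-- The variational capacity is bounded by the codimension-`q` Hausdorff content. -/
theorem variationalCapacity_le_sum (n : ℕ) {q : ℝ} (hq : 1 < q) :
    ∃ C : ℝ, 0 < C ∧ ∀ (K U : Set (EuclideanSpace ℝ (Fin n)))
      (s : Finset (EuclideanSpace ℝ (Fin n))) (ρ : EuclideanSpace ℝ (Fin n) → ℝ), s.Nonempty →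
      (∀ w ∈ s, 0 < ρ w) → K ⊆ ⋃ w ∈ s, Metric.ball w (ρ w) →
      (∀ w ∈ s, Metric.closedBall w (2 * ρ w) ⊆ U) →
      variationalCapacity q K U ≤ ENNReal.ofReal (C * ∑ w ∈ s, ρ w ^ ((n : ℝ) - q)) := by
  have hq0 : 0 < q := by linarith
  obtain ⟨C, hC, hcut⟩ := exists_cutoff_energy_le n hq0
  refine ⟨2 ^ q * C, by positivity, fun K U s ρ hs hρ hK hU => ?_⟩
  choose! φ hsm hnn hone hzero hen using hcut
  set ψ : EuclideanSpace ℝ (Fin n) → EuclideanSpace ℝ (Fin n) → ℝ := fun w => φ w (ρ w) with hψ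
  have hm : (0 : ℝ) < s.card := by exact_mod_cast hs.card_pos
  -- The shift keeps every term positive, so the `ℓ^q` norm `N` is smooth. Its size makes `N` equal
  -- to `1/2` off all the balls, so `2 * (N - 1/2)` is compactly supported and still at least `1`
  -- wherever some cutoff is `1`. The `ℓ^q` norm makes the energies add with a constant independent
  -- of the number of balls.
  set η : ℝ := 1 / 2 * (s.card : ℝ) ^ (-(1 / q)) with hη
  have hη0 : 0 < η := by positivity
  set N : EuclideanSpace ℝ (Fin n) → ℝ := fun x => (∑ w ∈ s, (ψ w x + η) ^ q) ^ (1 / q) with hN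
  have hterm : ∀ w ∈ s, ∀ x, 0 < ψ w x + η := fun w hw x =>
    add_pos_of_nonneg_of_pos (hnn w (ρ w) (hρ w hw) x) hη0
  have hψs : ∀ w ∈ s, ContDiff ℝ ∞ (ψ w) := fun w hw => hsm w (ρ w) (hρ w hw)
  have hNs : ContDiff ℝ ∞ N := by
    refine ContDiff.rpow_const_of_ne (ContDiff.sum fun w hw =>
      ContDiff.rpow_const_of_ne ((hψs w hw).add contDiff_const) fun x => (hterm w hw x).ne')
      fun x => ?_
    exact (Finset.sum_pos (fun w hw => Real.rpow_pos_of_pos (hterm w hw x) _) hs).ne'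
  have hNout : ∀ x, x ∉ ⋃ w ∈ s, Metric.closedBall w (2 * ρ w) → N x = 1 / 2 := by
    intro x hx
    simp only [Set.mem_iUnion, not_exists] at hx
    have h1 : ∑ w ∈ s, (ψ w x + η) ^ q = s.card * η ^ q := by
      rw [← nsmul_eq_mul, ← Finset.sum_const]
      refine Finset.sum_congr rfl fun w hw => ?_
      rw [hψ]
      simp only
      rw [hzero w (ρ w) (hρ w hw) x (hx w hw), zero_add]
    simp only [hN]
    rw [h1, Real.mul_rpow hm.le (by positivity), ← Real.rpow_mul hη0.le, mul_one_div_cancel hq0.ne',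
      Real.rpow_one, hη, Real.rpow_neg hm.le]
    field_simp
  have hclosed : IsClosed (⋃ w ∈ s, Metric.closedBall w (2 * ρ w)) :=
    s.finite_toSet.isClosed_biUnion fun w _ => Metric.isClosed_closedBall
  have hcompact : IsCompact (⋃ w ∈ s, Metric.closedBall w (2 * ρ w)) :=
    s.finite_toSet.isCompact_biUnion fun w _ => isCompact_closedBall w _
  have hts : tsupport (fun x => 2 * (N x - 1 / 2)) ⊆ ⋃ w ∈ s, Metric.closedBall w (2 * ρ w) := by
    refine closure_minimal (fun x hx => ?_) hclosed
    by_contra hx'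
    exact hx (by simp [hNout x hx'])
  have htest : IsTestFunction U fun x => 2 * (N x - 1 / 2) :=
    ⟨contDiff_const.mul (hNs.sub contDiff_const), hcompact.of_isClosed_subset (isClosed_tsupport _) hts,
      hts.trans (Set.iUnion₂_subset hU)⟩
  have hge : ∀ x ∈ K, 1 ≤ 2 * (N x - 1 / 2) := by
    intro x hx
    obtain ⟨w, hw, hxw⟩ := Set.mem_iUnion₂.1 (hK hx)
    have h1 : (1 : ℝ) ≤ ∑ w ∈ s, (ψ w x + η) ^ q := by
      refine le_trans ?_ (Finset.single_le_sum
        (fun w hw => Real.rpow_nonneg (hterm w hw x).le q) hw)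
      refine Real.one_le_rpow ?_ hq0.le
      rw [hψ]
      simp only
      rw [hone w (ρ w) (hρ w hw) x hxw]
      linarith
    have h2 : 1 ≤ N x := Real.one_le_rpow h1 (by positivity)
    linarith
  have hder : ∀ x, ‖fderiv ℝ (fun x => 2 * (N x - 1 / 2)) x‖ₑ ^ q ≤
      ENNReal.ofReal (2 ^ q) * ∑ w ∈ s, ‖fderiv ℝ (ψ w) x‖ₑ ^ q := by
    intro x
    obtain ⟨L, hL, hLle⟩ := exists_hasFDerivAt_rpow_sum hs hq (f := fun w x => ψ w x + η)
      (f' := fun w => fderiv ℝ (ψ w) x) (x := x) (fun w hw => hterm w hw x)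
      fun w hw => (((hψs w hw).differentiable (by simp)) x).hasFDerivAt.add_const η
    have h2 : HasFDerivAt (fun x => 2 * (N x - 1 / 2)) ((2 : ℝ) • L) x :=
      (hL.sub_const (1 / 2)).const_mul 2
    have h3 : ∀ M : EuclideanSpace ℝ (Fin n) →L[ℝ] ℝ, ‖M‖ₑ ^ q = ENNReal.ofReal (‖M‖ ^ q) := by
      intro M
      rw [← ENNReal.ofReal_rpow_of_nonneg (norm_nonneg _) hq0.le, ofReal_norm]
    rw [h2.fderiv]
    simp only [h3]
    rw [← ENNReal.ofReal_sum_of_nonneg fun _ _ => by positivity,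
      ← ENNReal.ofReal_mul (by positivity), norm_smul, Real.mul_rpow (norm_nonneg _) (norm_nonneg _),
      Real.norm_of_nonneg zero_le_two]
    gcongr
  calc variationalCapacity q K U
      ≤ ∫⁻ x in U, ‖fderiv ℝ (fun x => 2 * (N x - 1 / 2)) x‖ₑ ^ q :=
        iInf_le_of_le _ (iInf_le_of_le htest (iInf_le_of_le hge le_rfl))
    _ ≤ ∫⁻ x, ENNReal.ofReal (2 ^ q) * ∑ w ∈ s, ‖fderiv ℝ (ψ w) x‖ₑ ^ q :=
        (setLIntegral_le_lintegral _ _).trans (lintegral_mono hder)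
    _ = ENNReal.ofReal (2 ^ q) * ∑ w ∈ s, ∫⁻ x, ‖fderiv ℝ (ψ w) x‖ₑ ^ q := by
        have hmeas : ∀ w ∈ s, Measurable fun x => ‖fderiv ℝ (ψ w) x‖ₑ ^ q := fun w hw =>
          (((hψs w hw).continuous_fderiv (by simp)).enorm.measurable).pow_const q
        rw [lintegral_const_mul _ (Finset.measurable_fun_sum s hmeas), lintegral_finsetSum s hmeas]
    _ ≤ ENNReal.ofReal (2 ^ q) * ∑ w ∈ s, ENNReal.ofReal (C * ρ w ^ ((n : ℝ) - q)) := by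
        gcongr with w hw
        exact hen w (ρ w) (hρ w hw)
    _ = _ := by
        rw [← ENNReal.ofReal_sum_of_nonneg, ← ENNReal.ofReal_mul (by positivity), ← Finset.mul_sum,
          mul_assoc]
        intro w hw
        have := hρ w hw
        positivity

end Capacity

/-! ### The local estimate from fatness of the complement. -/

section FatComplement

variable {n : ℕ} {Ω : Set (EuclideanSpace ℝ (Fin n))}

theorem enorm_fderiv_eq_zero_of_tsupport_subset {u : EuclideanSpace ℝ (Fin n) → ℝ}
    (hu : tsupport u ⊆ Ω) {y : EuclideanSpace ℝ (Fin n)} (hy : y ∉ Ω) : ‖fderiv ℝ u y‖ₑ = 0 := by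
  rw [← ofReal_norm,
    image_eq_zero_of_notMem_tsupport fun h => hy (hu (tsupport_fderiv_subset ℝ h)), norm_zero,
    ENNReal.ofReal_zero]

theorem infDist_compl_pos (hΩ : IsOpen Ω) (hne : Ωᶜ.Nonempty) {x : EuclideanSpace ℝ (Fin n)}
    (hx : x ∈ Ω) : 0 < Metric.infDist x Ωᶜ :=
  (hΩ.isClosed_compl.notMem_iff_infDist_pos hne).1 fun h => h hx

/-- Near the complement, the distance weight with negative exponent only increases the energy. -/
theorem lintegral_ball_fderiv_le_weighted (hΩ : IsOpen Ω) {u : EuclideanSpace ℝ (Fin n) → ℝ}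
    (hu : tsupport u ⊆ Ω) {q : ℝ} (hq : 1 ≤ q) {w : EuclideanSpace ℝ (Fin n)} (hw : w ∈ Ωᶜ)
    {ρ : ℝ} (hρ : 0 < ρ) :
    ∫⁻ y in Metric.ball w ρ, ‖fderiv ℝ u y‖ₑ ≤ ENNReal.ofReal (ρ ^ (q - 1)) *
      ∫⁻ y in Metric.ball w ρ, ‖fderiv ℝ u y‖ₑ *
        ENNReal.ofReal (Metric.infDist y Ωᶜ ^ (1 - q)) := by
  rw [← lintegral_const_mul' _ _ ENNReal.ofReal_ne_top]
  refine setLIntegral_mono' measurableSet_ball fun y hy => ?_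
  by_cases hyΩ : y ∈ Ω
  · have hd := infDist_compl_pos hΩ ⟨w, hw⟩ hyΩ
    have hdρ : Metric.infDist y Ωᶜ ≤ ρ :=
      (Metric.infDist_le_dist_of_mem hw).trans (Metric.mem_ball.1 hy).le
    rw [mul_left_comm, ← ENNReal.ofReal_mul (by positivity)]
    refine le_mul_of_one_le_right' ?_
    rw [ENNReal.one_le_ofReal]
    calc (1 : ℝ) = ρ ^ (q - 1) * ρ ^ (1 - q) := by
          rw [← Real.rpow_add hρ]; simp
      _ ≤ _ := by
          gcongr ?_ * ?_
          exact Real.rpow_le_rpow_of_nonpos hd hdρ (by linarith)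
  · rw [enorm_fderiv_eq_zero_of_tsupport_subset hu hyΩ, zero_mul]
    exact zero_le

/-- Both endpoints appear because the exponent, later `n - q`, may have either sign. -/
theorem min_rpow_mul_le {a b D r : ℝ} (e : ℝ) (ha : 0 < a) (hD : 0 < D)
    (har : a * D ≤ r) (hrb : r ≤ b * D) : min (a ^ e) (b ^ e) * D ^ e ≤ r ^ e := by
  have hr : 0 < r := lt_of_lt_of_le (by positivity) har
  have hb : 0 < b := pos_of_mul_pos_left (hr.trans_le hrb) hD.le
  rcases le_total 0 e with he | he
  · calc _ ≤ a ^ e * D ^ e := by gcongr; exact min_le_left _ _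
      _ = (a * D) ^ e := (Real.mul_rpow ha.le hD.le).symm
      _ ≤ _ := by gcongr
  · calc _ ≤ b ^ e * D ^ e := by gcongr; exact min_le_right _ _
      _ = (b * D) ^ e := (Real.mul_rpow hb.le hD.le).symm
      _ ≤ _ := Real.rpow_le_rpow_of_nonpos hr hrb he

/-- A function vanishing on a uniformly `q`-fat complement is controlled in mean, on a Whitney ball,
by its gradient with the weight `d ^ (1 - q - δ)`. -/
theorem lintegral_ball_le_of_uniformlyFat (hΩ : IsOpen Ω) (hne : Ωᶜ.Nonempty) {q δ : ℝ} (hq : 1 < q)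
    (hδ : 0 < δ) (hfat : UniformlyFat q Ωᶜ) :
    ∃ C : ℝ, 0 < C ∧ ∀ u : EuclideanSpace ℝ (Fin n) → ℝ, ContDiff ℝ 1 u → tsupport u ⊆ Ω →
      ∀ x ∈ Ω, ∫⁻ y in Metric.ball x (Metric.infDist x Ωᶜ), ‖u y‖ₑ ≤
        ENNReal.ofReal (C * Metric.infDist x Ωᶜ ^ (q + δ)) *
          ∫⁻ y in Metric.ball x (5 * Metric.infDist x Ωᶜ), ‖fderiv ℝ u y‖ₑ *
            ENNReal.ofReal (Metric.infDist y Ωᶜ ^ (1 - (q + δ))) := by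
  obtain ⟨c, hc, hfat⟩ := hfat
  obtain ⟨C, hC, hcap⟩ := variationalCapacity_le_sum n hq
  set e : ℝ := n - q with he
  -- The first entry serves the case of one radius comparable to `D`, the second the case where all
  -- radii are small and fatness is used.
  set κ : ℝ := min (min ((1 / 20 : ℝ) ^ e) (3 ^ e)) (c / (C * 6 ^ e)) with hκ
  have hκ0 : 0 < κ := by positivity
  set κ' : ℝ := κ * 3 ^ (-((n : ℝ) - 1 + δ)) with hκ'
  have hκ'0 : 0 < κ' := by positivity
  refine ⟨3 / (δ * κ'), by positivity, fun u hu hsupp x hx => ?_⟩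
  set D := Metric.infDist x Ωᶜ with hD
  have hD0 : 0 < D := infDist_compl_pos hΩ hne hx
  set G : EuclideanSpace ℝ (Fin n) → ℝ≥0∞ := fun y => ‖fderiv ℝ u y‖ₑ *
    ENNReal.ofReal (Metric.infDist y Ωᶜ ^ (1 - (q + δ))) with hG
  obtain ⟨x₀, hx₀, hxx₀⟩ := hΩ.isClosed_compl.exists_infDist_eq_dist hne x
  by_contra! hlt
  obtain ⟨b, hb0, hblt, hbgt⟩ := ENNReal.lt_iff_exists_real_btwn.1 hlt
  -- Chosen so that decay with constant `a` from radius `3 * D` would force the integral of `|u|` to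
  -- be at most `b`.
  set a : ℝ := b * δ / (3 * D) with ha
  have ha0 : 0 ≤ a := by positivity
  have hab : a * (3 * D) / δ = b := by rw [ha]; field_simp
  set K := Ωᶜ ∩ Metric.closedBall x₀ D with hK
  have hdist : ∀ w ∈ K, dist w x ≤ 2 * D := fun w hw => by
    have h1 := Metric.mem_closedBall.1 hw.2
    have h2 := dist_triangle w x₀ x
    rw [dist_comm x₀ x, ← hxx₀] at h2
    linarith
  -- Radius `3 * D` suffices: `w` is within `2 * D` of `x`, so `B(w, 3D)` contains `B(x, D)`.
  have hstep : ∀ w ∈ K, ∃ t ∈ Set.Ioc (0 : ℝ) 1, ENNReal.ofReal (a * t ^ ((n : ℝ) - 1 + δ)) <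
      ∫⁻ y in Metric.ball w (t * (3 * D)), ‖fderiv ℝ u y‖ₑ := by
    intro w hw
    by_contra! hcon
    have huw : u w = 0 := image_eq_zero_of_notMem_tsupport fun h => hw.1 (hsupp h)
    have h1 := lintegral_ball_enorm_le_of_decay volume hu huw ha0 (R := 3 * D) (by positivity) hδ
      (by rwa [finrank_euclideanSpace_fin])
    rw [hab] at h1
    refine absurd hbgt (not_lt.2 (le_trans (lintegral_mono_set ?_) h1))
    refine Metric.ball_subset_ball' ?_
    have := hdist w hw
    rw [dist_comm] at this
    linarith
  choose! t ht htlt using hstep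
  set r : EuclideanSpace ℝ (Fin n) → ℝ := fun w => t w * (3 * D) with hr
  have hr0 : ∀ w ∈ K, 0 < r w := fun w hw => mul_pos (ht w hw).1 (by positivity)
  have hr3 : ∀ w ∈ K, r w ≤ 3 * D := fun w hw =>
    mul_le_of_le_one_left (by positivity) (ht w hw).2
  set A : ℝ := a * (3 * D) ^ (-((n : ℝ) - 1 + δ)) with hA
  have hA0 : 0 ≤ A := by positivity
  have hkey : ∀ w ∈ K, ENNReal.ofReal (A * r w ^ e) ≤ ∫⁻ y in Metric.ball w (r w), G y := by
    intro w hw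
    have hrw := hr0 w hw
    have h1 := (htlt w hw).le.trans
      (lintegral_ball_fderiv_le_weighted hΩ hsupp (q := q + δ) (by linarith) hw.1 hrw)
    have htw : t w = r w / (3 * D) := by simp only [hr]; field_simp
    have h2 : a * t w ^ ((n : ℝ) - 1 + δ) = r w ^ (q + δ - 1) * (A * r w ^ e) := by
      rw [htw, Real.div_rpow hrw.le (by positivity), hA, Real.rpow_neg (by positivity),
        show (n : ℝ) - 1 + δ = (q + δ - 1) + e by rw [he]; ring, Real.rpow_add hrw]
      field_simp
    rw [h2, ENNReal.ofReal_mul (by positivity)] at h1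
    exact (ENNReal.mul_le_mul_iff_right (by simpa using by positivity) ENNReal.ofReal_ne_top).1 h1
  have hsub : ∀ w ∈ K, Metric.ball w (r w) ⊆ Metric.ball x (5 * D) := fun w hw =>
    Metric.ball_subset_ball' (by linarith [hdist w hw, hr3 w hw])
  have hx₀K : x₀ ∈ K := ⟨hx₀, Metric.mem_closedBall_self hD0.le⟩
  have hmain : ENNReal.ofReal (κ * (A * D ^ e)) ≤ ∫⁻ y in Metric.ball x (5 * D), G y := by
    -- With all radii below `D / 20`, the balls of radius `12 * r w` needed for the cutoffs stay
    -- inside `B(x₀, 2D)`. A single larger radius already gives the bound.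
    by_cases hlarge : ∃ w ∈ K, 1 / 20 * D ≤ r w
    · obtain ⟨w, hw, hwr⟩ := hlarge
      refine le_trans (ENNReal.ofReal_le_ofReal ?_)
        ((hkey w hw).trans (lintegral_mono_set (hsub w hw)))
      have := min_rpow_mul_le e (by norm_num) hD0 hwr (hr3 w hw)
      calc κ * (A * D ^ e) ≤ min ((1 / 20 : ℝ) ^ e) (3 ^ e) * (A * D ^ e) := by
            gcongr
            exact min_le_left _ _
        _ = A * (min ((1 / 20 : ℝ) ^ e) (3 ^ e) * D ^ e) := by ring
        _ ≤ A * r w ^ e := by gcongr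
    · push Not at hlarge
      obtain ⟨v, hvK, hvdisj, hvcov⟩ :=
        Vitali.exists_disjoint_subfamily_covering_enlargement_closedBall K id r (1 / 20 * D)
          (fun w hw => (hlarge w hw).le) 5 (by norm_num)
      have hcompact : IsCompact K := (isCompact_closedBall x₀ D).inter_left hΩ.isClosed_compl
      -- Vitali gives closed balls enlarged five times; factor `6` makes them open, so compactness
      -- yields a finite subcover.
      obtain ⟨v', hv', hfin, hcov⟩ := hcompact.elim_finite_subcover_image (b := v)
        (c := fun w => Metric.ball w (6 * r w)) (fun _ _ => Metric.isOpen_ball) (by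
          intro w hw
          obtain ⟨z, hz, hwz⟩ := hvcov w hw
          refine Set.mem_iUnion₂.2 ⟨z, hz, ?_⟩
          have h1 := hwz (Metric.mem_closedBall_self (hr0 w hw).le)
          have h2 := hr0 z (hvK hz)
          refine Metric.closedBall_subset_ball (by linarith) h1)
      lift v' to Finset (EuclideanSpace ℝ (Fin n)) using hfin
      have hmemK : ∀ w ∈ v', w ∈ K := fun w hw => hvK (hv' hw)
      have hnonempty : v'.Nonempty := by
        obtain ⟨w, hw, -⟩ := Set.mem_iUnion₂.1 (hcov hx₀K)
        exact ⟨w, hw⟩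
      have hle := (hfat x₀ hx₀ D hD0).trans (hcap K (Metric.ball x₀ (2 * D)) v'
        (fun w => 6 * r w) hnonempty (fun w hw => mul_pos (by norm_num) (hr0 w (hmemK w hw))) hcov
        (fun w hw => Metric.closedBall_subset_ball' (by
          have h1 := Metric.mem_closedBall.1 (hmemK w hw).2
          have h2 := hlarge w (hmemK w hw)
          linarith)))
      have hsum0 : 0 ≤ ∑ w ∈ v', r w ^ e := Finset.sum_nonneg fun w hw =>
        Real.rpow_nonneg (hr0 w (hmemK w hw)).le _
      have hsum : ∑ w ∈ v', (6 * r w) ^ e = 6 ^ e * ∑ w ∈ v', r w ^ e := by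
        rw [Finset.mul_sum]
        exact Finset.sum_congr rfl fun w hw =>
          Real.mul_rpow (by norm_num) (hr0 w (hmemK w hw)).le
      rw [hsum, ENNReal.ofReal_le_ofReal_iff (by positivity), ← mul_assoc] at hle
      calc ENNReal.ofReal (κ * (A * D ^ e))
          ≤ ENNReal.ofReal (∑ w ∈ v', A * r w ^ e) := by
            refine ENNReal.ofReal_le_ofReal ?_
            rw [← Finset.mul_sum]
            calc κ * (A * D ^ e) ≤ c / (C * 6 ^ e) * (A * D ^ e) := by
                  gcongr
                  exact min_le_right _ _
              _ = A * (c * D ^ e / (C * 6 ^ e)) := by ring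
              _ ≤ _ := by
                  gcongr
                  rwa [div_le_iff₀' (by positivity)]
        _ = ∑ w ∈ v', ENNReal.ofReal (A * r w ^ e) :=
            ENNReal.ofReal_sum_of_nonneg fun w hw =>
              mul_nonneg hA0 (Real.rpow_nonneg (hr0 w (hmemK w hw)).le _)
        _ ≤ ∑ w ∈ v', ∫⁻ y in Metric.ball w (r w), G y :=
            Finset.sum_le_sum fun w hw => hkey w (hmemK w hw)
        _ = ∫⁻ y in ⋃ w ∈ v', Metric.ball w (r w), G y := by
            refine (lintegral_biUnion_finset ?_ (fun _ _ => measurableSet_ball) _).symm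
            exact fun w hw z hz hwz => (hvdisj (hv' hw) (hv' hz) hwz).mono
              Metric.ball_subset_closedBall Metric.ball_subset_closedBall
        _ ≤ _ := lintegral_mono_set (Set.iUnion₂_subset fun w hw => hsub w (hmemK w hw))
  refine absurd hblt (not_lt.2 ?_)
  refine le_trans (le_of_eq ?_) (mul_le_mul_right hmain _)
  rw [← ENNReal.ofReal_mul (by positivity)]
  congr 1
  rw [← hab, hA, Real.mul_rpow (by norm_num) hD0.le, hκ']
  -- The local estimate is scale invariant: all powers of the distance combine to the single `D` in
  -- `a * (3 * D) / δ`.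
  have h1 : D ^ (q + δ) * (D ^ (-((n : ℝ) - 1 + δ)) * D ^ e) = D := by
    rw [← Real.rpow_add hD0, ← Real.rpow_add hD0, he]
    ring_nf
    exact Real.rpow_one D
  calc a * (3 * D) / δ = a * (3 * (D ^ (q + δ) * (D ^ (-((n : ℝ) - 1 + δ)) * D ^ e))) / δ := by
        rw [h1]
    _ = _ := by field_simp

end FatComplement

/-! ### From local estimates to the global inequality for exponent one. -/

section WhitneyAveraging

variable {n : ℕ} {Ω : Set (EuclideanSpace ℝ (Fin n))}

theorem measurable_ofReal_infDist_rpow (S : Set (EuclideanSpace ℝ (Fin n))) (s : ℝ) :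
    Measurable fun x => ENNReal.ofReal (Metric.infDist x S ^ s) :=
  ((Metric.continuous_infDist_pt S).measurable.pow_const s).ennreal_ofReal

/-- Tonelli's theorem for averages over the balls `B(x, lam * d x)`. -/
theorem lintegral_infDist_ball_average (Ω : Set (EuclideanSpace ℝ (Fin n))) (lam s : ℝ)
    {f : EuclideanSpace ℝ (Fin n) → ℝ≥0∞} (hf : Measurable f) :
    ∫⁻ x in Ω, ENNReal.ofReal (Metric.infDist x Ωᶜ ^ s) *
        ∫⁻ y in Metric.ball x (lam * Metric.infDist x Ωᶜ), f y =
      ∫⁻ y, f y * ∫⁻ x in Ω ∩ {x | dist y x < lam * Metric.infDist x Ωᶜ},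
        ENNReal.ofReal (Metric.infDist x Ωᶜ ^ s) := by
  have hd : Continuous fun x => Metric.infDist x Ωᶜ := Metric.continuous_infDist_pt Ωᶜ
  have hset : MeasurableSet {p : EuclideanSpace ℝ (Fin n) × EuclideanSpace ℝ (Fin n) |
      dist p.2 p.1 < lam * Metric.infDist p.1 Ωᶜ} :=
    (isOpen_lt (by fun_prop) (by fun_prop)).measurableSet
  set k : EuclideanSpace ℝ (Fin n) → EuclideanSpace ℝ (Fin n) → ℝ≥0∞ := fun x y =>
    {p : EuclideanSpace ℝ (Fin n) × EuclideanSpace ℝ (Fin n) |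
      dist p.2 p.1 < lam * Metric.infDist p.1 Ωᶜ}.indicator
      (fun p => ENNReal.ofReal (Metric.infDist p.1 Ωᶜ ^ s) * f p.2) (x, y) with hk
  have hkm : Measurable (Function.uncurry k) :=
    (((measurable_ofReal_infDist_rpow Ωᶜ s).comp measurable_fst).mul
      (hf.comp measurable_snd)).indicator hset
  calc _ = ∫⁻ x in Ω, ∫⁻ y, k x y := by
        refine lintegral_congr fun x => ?_
        rw [← lintegral_const_mul' _ _ ENNReal.ofReal_ne_top, ← lintegral_indicator measurableSet_ball]
        rfl
    _ = ∫⁻ y, ∫⁻ x in Ω, k x y := lintegral_lintegral_swap hkm.aemeasurable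
    _ = _ := by
        refine lintegral_congr fun y => ?_
        have hyset : MeasurableSet {x | dist y x < lam * Metric.infDist x Ωᶜ} :=
          (isOpen_lt (by fun_prop) (by fun_prop)).measurableSet
        rw [← lintegral_const_mul _ (measurable_ofReal_infDist_rpow Ωᶜ s), Set.inter_comm,
          ← Measure.restrict_restrict hyset, ← lintegral_indicator hyset]
        refine lintegral_congr fun x => ?_
        simp only [hk, Set.indicator_apply, Set.mem_ofPred_eq, mul_comm]

/-- On the ball of half the distance around `y`, the distance function is comparable to its value at
`y`, so this ball alone supplies the bound. -/
theorem exists_le_lintegral_infDist_rpow (hΩ : IsOpen Ω) (hne : Ωᶜ.Nonempty) {q : ℝ} (hq : 0 ≤ q) :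
    ∃ c : ℝ, 0 < c ∧ ∀ y ∈ Ω, ENNReal.ofReal (c * Metric.infDist y Ωᶜ ^ (-q)) ≤
      ∫⁻ x in Ω ∩ {x | dist y x < 1 * Metric.infDist x Ωᶜ},
        ENNReal.ofReal (Metric.infDist x Ωᶜ ^ (-q - n)) := by
  set v : ℝ := (volume (Metric.ball (0 : EuclideanSpace ℝ (Fin n)) 1)).toReal with hv
  have hv0 : 0 < v := ENNReal.toReal_pos (Metric.measure_ball_pos _ _ one_pos).ne'
    measure_ball_lt_top.ne
  refine ⟨(3 / 2) ^ (-q - n) * (1 / 2) ^ n * v, by positivity, fun y hy => ?_⟩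
  set D := Metric.infDist y Ωᶜ with hD
  have hD0 : 0 < D := infDist_compl_pos hΩ hne hy
  have hdist : ∀ x ∈ Metric.ball y (D / 2), D / 2 < Metric.infDist x Ωᶜ ∧
      Metric.infDist x Ωᶜ ≤ 3 / 2 * D := fun x hx => by
    have h1 := Metric.infDist_le_infDist_add_dist (s := Ωᶜ) (x := x) (y := y)
    have h2 := Metric.infDist_le_infDist_add_dist (s := Ωᶜ) (x := y) (y := x)
    rw [dist_comm] at h2
    have h3 := Metric.mem_ball.1 hx
    constructor <;> linarith
  have hsub : Metric.ball y (D / 2) ⊆ Ω ∩ {x | dist y x < 1 * Metric.infDist x Ωᶜ} := by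
    intro x hx
    have h1 := (hdist x hx).1
    refine ⟨by_contra fun hxΩ => ?_, ?_⟩
    · rw [Metric.infDist_zero_of_mem (show x ∈ Ωᶜ from hxΩ)] at h1
      linarith
    · have h3 := Metric.mem_ball'.1 hx
      simp only [Set.mem_ofPred_eq]
      linarith
  calc _ = ENNReal.ofReal ((3 / 2 * D) ^ (-q - n)) * volume (Metric.ball y (D / 2)) := by
        rw [Measure.addHaar_ball_of_pos _ _ (by positivity), finrank_euclideanSpace_fin,
          ← ENNReal.ofReal_toReal
            (measure_ball_lt_top (μ := volume) (x := (0 : EuclideanSpace ℝ (Fin n))) (r := 1)).ne,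
          ← hv, ← ENNReal.ofReal_mul (by positivity), ← ENNReal.ofReal_mul (by positivity)]
        congr 1
        rw [Real.mul_rpow (by norm_num) hD0.le, Real.rpow_sub_natCast hD0.ne', div_pow, div_pow, one_pow]
        field_simp
    _ = ∫⁻ x in Metric.ball y (D / 2), ENNReal.ofReal ((3 / 2 * D) ^ (-q - n)) := by
        rw [setLIntegral_const]
    _ ≤ ∫⁻ x in Metric.ball y (D / 2), ENNReal.ofReal (Metric.infDist x Ωᶜ ^ (-q - n)) := by
        refine setLIntegral_mono' measurableSet_ball fun x hx => ENNReal.ofReal_le_ofReal ?_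
        obtain ⟨h1, h2⟩ := hdist x hx
        have hn : (0 : ℝ) ≤ n := n.cast_nonneg
        exact Real.rpow_le_rpow_of_nonpos (by linarith) h2 (by linarith)
    _ ≤ _ := lintegral_mono_set hsub

/-- On the domain of integration `11 * d x ≥ d y + dist y x`, where `d` is the distance to the
complement. Rescaling by `d y` reduces the integral to that of `(1 + ‖z‖) ^ (-(n + ε))`, finite
because `ε > 0`. -/
theorem exists_lintegral_infDist_rpow_le (hΩ : IsOpen Ω) (hne : Ωᶜ.Nonempty) {ε : ℝ} (hε : 0 < ε) :
    ∃ C : ℝ, 0 < C ∧ ∀ y ∈ Ω, ∫⁻ x in Ω ∩ {x | dist y x < 5 * Metric.infDist x Ωᶜ},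
        ENNReal.ofReal (Metric.infDist x Ωᶜ ^ (-(n + ε))) ≤
      ENNReal.ofReal (C * Metric.infDist y Ωᶜ ^ (-ε)) := by
  set H : EuclideanSpace ℝ (Fin n) → ℝ≥0∞ := fun z => ENNReal.ofReal ((1 + ‖z‖) ^ (-(n + ε)))
    with hH
  have hHm : Measurable H := by
    have : Measurable fun z : EuclideanSpace ℝ (Fin n) => 1 + ‖z‖ := by fun_prop
    exact (this.pow_const _).ennreal_ofReal
  have hfin : ∫⁻ z, H z < ⊤ := by
    refine finite_integral_one_add_norm ?_
    rw [finrank_euclideanSpace_fin]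
    linarith
  set I := (∫⁻ z, H z).toReal with hI
  refine ⟨11 ^ ((n : ℝ) + ε) * (I + 1), by positivity, fun y hy => ?_⟩
  set D := Metric.infDist y Ωᶜ with hD
  have hD0 : 0 < D := infDist_compl_pos hΩ hne hy
  have hDi : 0 < D⁻¹ := inv_pos.2 hD0
  have hn : (0 : ℝ) ≤ n := n.cast_nonneg
  have hset : MeasurableSet {x | dist y x < 5 * Metric.infDist x Ωᶜ} :=
    (isOpen_lt (by fun_prop) ((Metric.continuous_infDist_pt Ωᶜ).const_mul 5)).measurableSet
  calc _ ≤ ∫⁻ x in Ω ∩ {x | dist y x < 5 * Metric.infDist x Ωᶜ},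
        ENNReal.ofReal ((D / 11) ^ (-(n + ε))) * H (-(D⁻¹ • y) + D⁻¹ • x) := by
        refine setLIntegral_mono' (hΩ.measurableSet.inter hset) fun x hx => ?_
        rw [← ENNReal.ofReal_mul (by positivity)]
        refine ENNReal.ofReal_le_ofReal ?_
        have hx2 : dist y x < 5 * Metric.infDist x Ωᶜ := hx.2
        have h1 := Metric.infDist_le_infDist_add_dist (s := Ωᶜ) (x := y) (y := x)
        have h2 : ‖-(D⁻¹ • y) + D⁻¹ • x‖ = D⁻¹ * dist y x := by
          rw [neg_add_eq_sub, ← smul_sub, norm_smul, Real.norm_of_nonneg hDi.le, dist_comm,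
            dist_eq_norm]
        rw [h2, ← Real.mul_rpow (by positivity) (by positivity)]
        refine Real.rpow_le_rpow_of_nonpos (by positivity) ?_ (by linarith)
        have h3 : D / 11 * (1 + D⁻¹ * dist y x) = (D + dist y x) / 11 := by field_simp
        rw [h3]
        linarith
    _ ≤ ∫⁻ x, ENNReal.ofReal ((D / 11) ^ (-(n + ε))) * H (-(D⁻¹ • y) + D⁻¹ • x) :=
        setLIntegral_le_lintegral _ _
    _ = ENNReal.ofReal (11 ^ ((n : ℝ) + ε) * I * D ^ (-ε)) := by
        rw [lintegral_const_mul' _ _ ENNReal.ofReal_ne_top, lintegral_comp_add_smul _ hHm _ hDi,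
          finrank_euclideanSpace_fin, ← ENNReal.ofReal_toReal hfin.ne, ← hI,
          ← ENNReal.ofReal_mul (by positivity), ← ENNReal.ofReal_mul (by positivity)]
        congr 1
        rw [Real.div_rpow hD0.le (by norm_num), Real.inv_rpow hD0.le,
          Real.rpow_neg (by norm_num : (0 : ℝ) ≤ 11), neg_add, Real.rpow_add hD0]
        have : 0 < D ^ (-(n : ℝ)) := by positivity
        field_simp
    _ ≤ _ := by
        gcongr
        linarith

/-- The `(1, 1 - q)`-Hardy inequality. -/
theorem exists_lintegral_hardy_one (hΩ : IsOpen Ω) (hne : Ωᶜ.Nonempty) {q₀ q : ℝ} (hq₀ : 1 < q₀)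
    (hq : q₀ < q) (hfat : UniformlyFat q₀ Ωᶜ) :
    ∃ C : ℝ, 0 < C ∧ ∀ u : EuclideanSpace ℝ (Fin n) → ℝ, ContDiff ℝ 1 u → tsupport u ⊆ Ω →
      ∫⁻ x in Ω, ‖u x‖ₑ * ENNReal.ofReal (Metric.infDist x Ωᶜ ^ (-q)) ≤ ENNReal.ofReal C *
        ∫⁻ x in Ω, ‖fderiv ℝ u x‖ₑ * ENNReal.ofReal (Metric.infDist x Ωᶜ ^ (1 - q)) := by
  -- Half the gap is the `δ` of the local estimate; the other half makes the averaging kernel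
  -- integrable at infinity.
  set ε : ℝ := (q - q₀) / 2 with hε
  have hε0 : 0 < ε := by rw [hε]; linarith
  obtain ⟨C₁, hC₁, hlocal⟩ := lintegral_ball_le_of_uniformlyFat hΩ hne hq₀ hε0 hfat
  obtain ⟨c, hc, hlow⟩ := exists_le_lintegral_infDist_rpow hΩ hne (q := q) (by linarith)
  obtain ⟨C₂, hC₂, hupp⟩ := exists_lintegral_infDist_rpow_le hΩ hne hε0
  refine ⟨c⁻¹ * (C₁ * C₂), by positivity, fun u hu hsupp => ?_⟩
  have hcancel : ∀ z : ℝ≥0∞, ENNReal.ofReal c⁻¹ * (ENNReal.ofReal c * z) = z := fun z => by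
    rw [← mul_assoc, ← ENNReal.ofReal_mul (by positivity), inv_mul_cancel₀ hc.ne',
      ENNReal.ofReal_one, one_mul]
  set G : EuclideanSpace ℝ (Fin n) → ℝ≥0∞ := fun y => ‖fderiv ℝ u y‖ₑ *
    ENNReal.ofReal (Metric.infDist y Ωᶜ ^ (1 - (q₀ + ε))) with hG
  have hGm : Measurable G :=
    (hu.continuous_fderiv one_ne_zero).enorm.measurable.mul (measurable_ofReal_infDist_rpow _ _)
  have hlower : ENNReal.ofReal c *
      ∫⁻ x in Ω, ‖u x‖ₑ * ENNReal.ofReal (Metric.infDist x Ωᶜ ^ (-q)) ≤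
      ∫⁻ x in Ω, ENNReal.ofReal (Metric.infDist x Ωᶜ ^ (-q - n)) *
        ∫⁻ y in Metric.ball x (1 * Metric.infDist x Ωᶜ), ‖u y‖ₑ := by
    rw [lintegral_infDist_ball_average Ω 1 (-q - n) hu.continuous.enorm.measurable,
      ← lintegral_const_mul' _ _ ENNReal.ofReal_ne_top]
    refine le_trans (setLIntegral_mono' hΩ.measurableSet fun y hy => ?_)
      (setLIntegral_le_lintegral Ω _)
    rw [mul_left_comm, ← ENNReal.ofReal_mul hc.le]
    gcongr
    exact hlow y hy
  have hmid : ∫⁻ x in Ω, ENNReal.ofReal (Metric.infDist x Ωᶜ ^ (-q - n)) *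
        ∫⁻ y in Metric.ball x (1 * Metric.infDist x Ωᶜ), ‖u y‖ₑ ≤
      ENNReal.ofReal C₁ * ∫⁻ x in Ω, ENNReal.ofReal (Metric.infDist x Ωᶜ ^ (-(n + ε))) *
        ∫⁻ y in Metric.ball x (5 * Metric.infDist x Ωᶜ), G y := by
    rw [← lintegral_const_mul' _ _ ENNReal.ofReal_ne_top]
    refine setLIntegral_mono' hΩ.measurableSet fun x hx => ?_
    have hD0 := infDist_compl_pos hΩ hne hx
    rw [one_mul]
    refine (mul_le_mul_right (hlocal u hu hsupp x hx) _).trans (le_of_eq ?_)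
    rw [← mul_assoc, ← mul_assoc, ← ENNReal.ofReal_mul (by positivity), ← ENNReal.ofReal_mul hC₁.le]
    congr 2
    rw [mul_left_comm, ← Real.rpow_add hD0]
    congr 2
    rw [hε]
    ring
  have hupper : ∫⁻ x in Ω, ENNReal.ofReal (Metric.infDist x Ωᶜ ^ (-(n + ε))) *
        ∫⁻ y in Metric.ball x (5 * Metric.infDist x Ωᶜ), G y ≤ ENNReal.ofReal C₂ *
      ∫⁻ x in Ω, ‖fderiv ℝ u x‖ₑ * ENNReal.ofReal (Metric.infDist x Ωᶜ ^ (1 - q)) := by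
    rw [lintegral_infDist_ball_average Ω 5 (-(n + ε)) hGm,
      ← lintegral_const_mul' _ _ ENNReal.ofReal_ne_top, ← lintegral_indicator hΩ.measurableSet]
    refine lintegral_mono fun y => ?_
    by_cases hy : y ∈ Ω
    · rw [Set.indicator_of_mem hy]
      have hD0 := infDist_compl_pos hΩ hne hy
      refine (mul_le_mul_right (hupp y hy) _).trans (le_of_eq ?_)
      rw [hG]
      simp only
      rw [mul_assoc, mul_left_comm (ENNReal.ofReal C₂), ← ENNReal.ofReal_mul (by positivity),
        ← ENNReal.ofReal_mul hC₂.le]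
      congr 2
      rw [mul_left_comm, ← Real.rpow_add hD0]
      congr 2
      rw [hε]
      ring
    · rw [hG]
      simp only
      rw [enorm_fderiv_eq_zero_of_tsupport_subset hsupp hy, zero_mul, zero_mul]
      exact zero_le
  calc _ = ENNReal.ofReal c⁻¹ * (ENNReal.ofReal c *
        ∫⁻ x in Ω, ‖u x‖ₑ * ENNReal.ofReal (Metric.infDist x Ωᶜ ^ (-q))) := (hcancel _).symm
    _ ≤ ENNReal.ofReal c⁻¹ * (ENNReal.ofReal C₁ * (ENNReal.ofReal C₂ *
        ∫⁻ x in Ω, ‖fderiv ℝ u x‖ₑ * ENNReal.ofReal (Metric.infDist x Ωᶜ ^ (1 - q)))) :=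
        mul_le_mul_right (hlower.trans (hmid.trans (mul_le_mul_right hupper _))) _
    _ = _ := by
        rw [ENNReal.ofReal_mul (by positivity), ENNReal.ofReal_mul hC₁.le]
        ring

end WhitneyAveraging

/-! ### Passage from exponent one to `p`, and the conclusion. -/

section Hardy

variable {n : ℕ} {Ω : Set (EuclideanSpace ℝ (Fin n))}

theorem infEDist_frontier_eq_ofReal_infDist_compl (hΩ : IsOpen Ω) (hne : Ωᶜ.Nonempty)
    {x : EuclideanSpace ℝ (Fin n)} (hx : x ∈ Ω) :
    Metric.infEDist x (frontier Ω) = ENNReal.ofReal (Metric.infDist x Ωᶜ) := by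
  have hΩne : Ω ≠ Set.univ := fun h => by simp [h] at hne
  obtain ⟨y, hy, hxy⟩ := exists_mem_frontier_infDist_compl_eq_dist hx hΩne
  refine le_antisymm ?_ ?_
  · rw [hxy, ← edist_dist]
    exact Metric.infEDist_le_edist_of_mem hy
  · rw [Metric.infDist, ENNReal.ofReal_toReal (Metric.infEDist_ne_top hne)]
    refine Metric.infEDist_anti ?_
    rw [hΩ.frontier_eq]
    exact fun z hz => hz.2

/-- This finiteness permits the absorption of the left side. The weight is continuous on the compact
support, where the distance is positive. -/
theorem lintegral_rpow_mul_infDist_rpow_lt_top (hΩ : IsOpen Ω) (hne : Ωᶜ.Nonempty) {p : ℝ}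
    (hp : 0 < p) (s : ℝ) {u : EuclideanSpace ℝ (Fin n) → ℝ} (hu : Continuous u)
    (hcs : HasCompactSupport u) (hsupp : tsupport u ⊆ Ω) :
    ∫⁻ x in Ω, ‖u x‖ₑ ^ p * ENNReal.ofReal (Metric.infDist x Ωᶜ ^ s) < ⊤ := by
  have hcont : ContinuousOn (fun x => ‖u x‖ ^ p * Metric.infDist x Ωᶜ ^ s) (tsupport u) :=
    (hu.norm.rpow_const fun _ => Or.inr hp.le).continuousOn.mul
      ((Metric.continuous_infDist_pt Ωᶜ).continuousOn.rpow_const fun x hx =>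
        Or.inl (infDist_compl_pos hΩ hne (hsupp hx)).ne')
  obtain ⟨B, hB⟩ := hcs.isCompact.exists_bound_of_continuousOn hcont
  calc _ ≤ ∫⁻ x, (tsupport u).indicator (fun _ => ENNReal.ofReal B) x := by
        refine (setLIntegral_le_lintegral _ _).trans (lintegral_mono fun x => ?_)
        by_cases hx : x ∈ tsupport u
        · rw [Set.indicator_of_mem hx]
          rw [← ofReal_norm, ENNReal.ofReal_rpow_of_nonneg (norm_nonneg _) hp.le,
            ← ENNReal.ofReal_mul (by positivity)]
          exact ENNReal.ofReal_le_ofReal ((Real.le_norm_self _).trans (hB x hx))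
        · rw [Set.indicator_of_notMem hx, image_eq_zero_of_notMem_tsupport hx, enorm_zero,
            ENNReal.zero_rpow_of_pos hp, zero_mul]
    _ = ENNReal.ofReal B * volume (tsupport u) :=
        lintegral_indicator_const (isClosed_tsupport u).measurableSet _
    _ < ⊤ := ENNReal.mul_lt_top ENNReal.ofReal_lt_top hcs.isCompact.measure_lt_top

theorem ENNReal.le_rpow_mul_of_le_mul_rpow {p : ℝ} (hp : 1 < p) {I J C : ℝ≥0∞} (hI : I ≠ ⊤)
    (h : I ≤ C * (I ^ ((p - 1) / p) * J ^ (1 / p))) : I ≤ C ^ p * J := by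
  have hp0 : 0 < p := by linarith
  rcases eq_or_ne I 0 with h0 | h0
  · rw [h0]
    exact zero_le
  have hsplit : I = I ^ ((p - 1) / p) * I ^ (1 / p) := by
    rw [← ENNReal.rpow_add _ _ h0 hI, ← add_div, sub_add_cancel, div_self hp0.ne', ENNReal.rpow_one]
  have h1 : I ^ ((p - 1) / p) * I ^ (1 / p) ≤ I ^ ((p - 1) / p) * (C * J ^ (1 / p)) := by
    rw [← hsplit, mul_left_comm]
    exact h
  have hpos : I ^ ((p - 1) / p) ≠ 0 := (ENNReal.rpow_pos (pos_iff_ne_zero.2 h0) hI).ne'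
  have hfin : I ^ ((p - 1) / p) ≠ ⊤ :=
    ENNReal.rpow_ne_top_of_nonneg (div_nonneg (by linarith) hp0.le) hI
  have h2 := (ENNReal.mul_le_mul_iff_right hpos hfin).1 h1
  have h3 := ENNReal.rpow_le_rpow h2 hp0.le
  rwa [ENNReal.mul_rpow_of_nonneg _ _ hp0.le, ← ENNReal.rpow_mul, ← ENNReal.rpow_mul,
    one_div_mul_cancel hp0.ne', ENNReal.rpow_one, ENNReal.rpow_one] at h3

/-- The weighted `p`-Hardy inequality follows from the case `p = 1` applied to `|u| ^ p`. -/
theorem lintegral_hardy_of_hardy_one (hΩ : IsOpen Ω) (hne : Ωᶜ.Nonempty) {p β C : ℝ} (hp : 1 < p)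
    (hC : 0 < C)
    (hone : ∀ u : EuclideanSpace ℝ (Fin n) → ℝ, ContDiff ℝ 1 u → tsupport u ⊆ Ω →
      ∫⁻ x in Ω, ‖u x‖ₑ * ENNReal.ofReal (Metric.infDist x Ωᶜ ^ (β - p)) ≤ ENNReal.ofReal C *
        ∫⁻ x in Ω, ‖fderiv ℝ u x‖ₑ * ENNReal.ofReal (Metric.infDist x Ωᶜ ^ (1 + (β - p))))
    {u : EuclideanSpace ℝ (Fin n) → ℝ} (hu : ContDiff ℝ 1 u) (hcs : HasCompactSupport u)
    (hsupp : tsupport u ⊆ Ω) :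
    ∫⁻ x in Ω, ‖u x‖ₑ ^ p * ENNReal.ofReal (Metric.infDist x Ωᶜ ^ (β - p)) ≤
      ENNReal.ofReal ((C * p) ^ p) *
        ∫⁻ x in Ω, ‖fderiv ℝ u x‖ₑ ^ p * ENNReal.ofReal (Metric.infDist x Ωᶜ ^ β) := by
  have hp0 : 0 < p := by linarith
  have hp1 : 0 < p - 1 := by linarith
  have hIfin := lintegral_rpow_mul_infDist_rpow_lt_top hΩ hne hp0 (β - p) hu.continuous hcs hsupp
  set I := ∫⁻ x in Ω, ‖u x‖ₑ ^ p * ENNReal.ofReal (Metric.infDist x Ωᶜ ^ (β - p)) with hI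
  set J := ∫⁻ x in Ω, ‖fderiv ℝ u x‖ₑ ^ p * ENNReal.ofReal (Metric.infDist x Ωᶜ ^ β) with hJ
  set f : EuclideanSpace ℝ (Fin n) → ℝ≥0∞ := fun x => ‖u x‖ₑ ^ (p - 1) *
    ENNReal.ofReal (Metric.infDist x Ωᶜ ^ ((β - p) * ((p - 1) / p))) with hf
  set g : EuclideanSpace ℝ (Fin n) → ℝ≥0∞ := fun x => ‖fderiv ℝ u x‖ₑ *
    ENNReal.ofReal (Metric.infDist x Ωᶜ ^ (β / p)) with hg
  have hfm : Measurable f :=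
    (hu.continuous.enorm.measurable.pow_const _).mul (measurable_ofReal_infDist_rpow _ _)
  have hgm : Measurable g :=
    (hu.continuous_fderiv one_ne_zero).enorm.measurable.mul (measurable_ofReal_infDist_rpow _ _)
  have hvsupp : tsupport (fun x => ‖u x‖ ^ p) ⊆ Ω := by
    refine (closure_mono fun x hx => ?_).trans hsupp
    refine fun h0 => hx ?_
    simp [h0, hp0.ne']
  have hlhs : ∫⁻ x in Ω, ‖‖u x‖ ^ p‖ₑ * ENNReal.ofReal (Metric.infDist x Ωᶜ ^ (β - p)) = I := by
    refine lintegral_congr fun x => ?_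
    rw [Real.enorm_of_nonneg (by positivity), ← ENNReal.ofReal_rpow_of_nonneg (norm_nonneg _) hp0.le,
      ofReal_norm]
  have hrhs : ∫⁻ x in Ω, ‖fderiv ℝ (fun x => ‖u x‖ ^ p) x‖ₑ *
      ENNReal.ofReal (Metric.infDist x Ωᶜ ^ (1 + (β - p))) ≤
      ENNReal.ofReal p * ∫⁻ x in Ω, (f * g) x := by
    rw [← lintegral_const_mul' _ _ ENNReal.ofReal_ne_top]
    refine setLIntegral_mono' hΩ.measurableSet fun x hx => ?_
    have hd := infDist_compl_pos hΩ hne hx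
    have h1 : ‖fderiv ℝ (fun x => ‖u x‖ ^ p) x‖ₑ ≤
        ENNReal.ofReal p * ‖u x‖ₑ ^ (p - 1) * ‖fderiv ℝ u x‖ₑ := by
      rw [← ofReal_norm, ← ofReal_norm (u x), ← ofReal_norm (fderiv ℝ u x),
        ENNReal.ofReal_rpow_of_nonneg (norm_nonneg _) hp1.le, ← ENNReal.ofReal_mul hp0.le,
        ← ENNReal.ofReal_mul (by positivity)]
      exact ENNReal.ofReal_le_ofReal (norm_fderiv_norm_rpow_le (hu.differentiable one_ne_zero) hp)
    -- The weight is split so that the Hölder powers of `f` and `g` reproduce exactly the integrands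
    -- of `I` and `J`.
    have h2 : ENNReal.ofReal (Metric.infDist x Ωᶜ ^ (1 + (β - p))) =
        ENNReal.ofReal (Metric.infDist x Ωᶜ ^ ((β - p) * ((p - 1) / p))) *
          ENNReal.ofReal (Metric.infDist x Ωᶜ ^ (β / p)) := by
      rw [← ENNReal.ofReal_mul (by positivity), ← Real.rpow_add hd]
      congr 2
      field_simp
      ring
    calc _ ≤ ENNReal.ofReal p * ‖u x‖ₑ ^ (p - 1) * ‖fderiv ℝ u x‖ₑ * _ :=
          mul_le_mul_left h1 _
      _ = _ := by
          rw [h2, hf, hg]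
          simp only [Pi.mul_apply]
          ring
  have hholder : ∫⁻ x in Ω, (f * g) x ≤ I ^ ((p - 1) / p) * J ^ (1 / p) := by
    have hconj : (p / (p - 1)).HolderConjugate p := (Real.HolderConjugate.conjExponent hp).symm
    have h1 := ENNReal.lintegral_mul_le_Lp_mul_Lq (volume.restrict Ω) hconj hfm.aemeasurable
      hgm.aemeasurable
    refine h1.trans (le_of_eq ?_)
    rw [one_div_div]
    congr 2
    · refine setLIntegral_congr_fun hΩ.measurableSet fun x hx => ?_
      have hd := infDist_compl_pos hΩ hne hx
      rw [hf]
      simp only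
      rw [ENNReal.mul_rpow_of_nonneg _ _ (by positivity), ← ENNReal.rpow_mul,
        ENNReal.ofReal_rpow_of_pos (by positivity), ← Real.rpow_mul hd.le]
      congr 2
      · field_simp
      · congr 1
        field_simp
    · refine setLIntegral_congr_fun hΩ.measurableSet fun x hx => ?_
      have hd := infDist_compl_pos hΩ hne hx
      rw [hg]
      simp only
      rw [ENNReal.mul_rpow_of_nonneg _ _ hp0.le, ENNReal.ofReal_rpow_of_pos (by positivity),
        ← Real.rpow_mul hd.le, div_mul_cancel₀ _ hp0.ne']
  rw [← ENNReal.ofReal_rpow_of_pos (by positivity)]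
  refine ENNReal.le_rpow_mul_of_le_mul_rpow hp hIfin.ne ?_
  calc I ≤ ENNReal.ofReal C * (ENNReal.ofReal p * (I ^ ((p - 1) / p) * J ^ (1 / p))) := by
        rw [← hlhs]
        refine (hone _ (hu.norm_rpow hp) hvsupp).trans ?_
        rw [hlhs]
        gcongr
        exact hrhs.trans (by gcongr)
    _ = _ := by rw [ENNReal.ofReal_mul hC.le, mul_assoc]

end Hardy

theorem corollary1p3 {n : ℕ} (Ω : Set (EuclideanSpace ℝ (Fin n))) (hΩ : IsOpen Ω)
    (s : ℝ) (hs : 1 ≤ s) (hfat : ∀ q : ℝ, s < q → UniformlyFat q Ωᶜ)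
    (p β : ℝ) (hp : 1 < p) (hβ : β < p - s) :
    AdmitsHardyInequality p β Ω := by
  rcases Ωᶜ.eq_empty_or_nonempty with hemp | hne
  · refine ⟨1, one_pos, fun u _ => ?_⟩
    have hneg : β - p < 0 := by linarith
    rw [Set.compl_empty_iff.1 hemp, frontier_univ]
    simp [Metric.infEDist_empty, ENNReal.top_rpow_of_neg hneg]
  -- The midpoint of `s` and `p - β` lies strictly between them, and exceeds `1` since `s ≥ 1`.
  · obtain ⟨C, hC, hone⟩ := exists_lintegral_hardy_one hΩ hne (q₀ := (s + (p - β)) / 2)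
      (q := p - β) (by linarith) (by linarith) (hfat _ (by linarith))
    rw [neg_sub, show 1 - (p - β) = 1 + (β - p) by ring] at hone
    have hCp : 0 < (C * p) ^ p := by
      have : 0 < p := by linarith
      positivity
    refine ⟨((C * p) ^ p).toNNReal, Real.toNNReal_pos.2 hCp, fun u hu => ?_⟩
    have hmain := lintegral_hardy_of_hardy_one hΩ hne hp hC hone (hu.1.of_le (by simp)) hu.2.1 hu.2.2
    have hweight : ∀ (f : EuclideanSpace ℝ (Fin n) → ℝ≥0∞) (r : ℝ),
        ∫⁻ x in Ω, f x * Metric.infEDist x (frontier Ω) ^ r =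
          ∫⁻ x in Ω, f x * ENNReal.ofReal (Metric.infDist x Ωᶜ ^ r) := fun f r =>
      setLIntegral_congr_fun hΩ.measurableSet fun x hx => by
        rw [infEDist_frontier_eq_ofReal_infDist_compl hΩ hne hx,
          ENNReal.ofReal_rpow_of_pos (infDist_compl_pos hΩ hne hx)]
    exact (hweight (fun x => ‖u x‖ₑ ^ p) (β - p)).le.trans
      (hmain.trans_eq (congrArg _ (hweight (fun x => ‖fderiv ℝ u x‖ₑ ^ p) β).symm))
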